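/- Let $\mathcal A\subseteq B(H)$ be a von Neumann algebra on a complex Hilbert space $H$. All subalgebras are unital, with the same unit as $\mathcal A$. A *total ideal* of $\mathcal A$ is an ultraweakly closed two-sided ideal of $\mathcal A$. A *partial ideal* of $\mathcal A$ is a map $\pi$ that assigns to each commutative sub-von-Neumann-algebra $V$ of $\mathcal A$ an ultraweakly closed ideal $\pi(V)$ of $V$ such that $\pi(V)=\pi(V')\cap V$ whenever $V\subseteq V'$. A partial ideal $\pi$ is *invariant* if $\pi(uVu^*)=u\,\pi(V)\,u^*$ for every commutative sub-von-Neumann-algebra $V$ of $\mathcal A$ and every unitary $u\in\mathcal A$. Each total ideal $I$ of $\mathcal A$ determines a partial ideal $\pi_I$ by $\pi_I(V)=I\cap V$. Theorem. A partial ideal $\pi$ of $\mathcal A$ arises from a total ideal, i.e. there is a total ideal $I$ of $\mathcal A$ with $\pi(V)=I\cap V$ for every commutative sub-von-Neumann-algebra $V$ of $\mathcal A$, if and only if $\pi$ is invariant. Consequently, the map $I\mapsto\pi_I$ is a bijection from the set of total ideals of $\mathcal A$ onto the set of invariant partial ideals of $\mathcal A$. -/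

import Mathlib

universe u

open scoped Topology

section PartialIdeals

variable {H : Type u} [NormedAddCommGroup H] [InnerProductSpace ℂ H] [CompleteSpace H]

/-- Pairs of square-summable sequences of vectors of `H`. -/
def SqSummablePair (H : Type u) [NormedAddCommGroup H] : Type u :=
  {p : (ℕ → H) × (ℕ → H) // (Summable fun n => ‖p.1 n‖ ^ 2) ∧ (Summable fun n => ‖p.2 n‖ ^ 2)}

/-- The functional `x ↦ ∑ₙ ⟨ξₙ, x ηₙ⟩` on `B(H)`, for square-summable sequences `ξ` and `η`
(the series then converges absolutely). -/
noncomputable def SqSummablePair.functional (p : SqSummablePair H) (x : H →L[ℂ] H) : ℂ :=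
  ∑' n, inner ℂ (p.1.1 n) (x (p.1.2 n))

/-- The ultraweak (σ-weak) topology on `B(H)`: the coarsest topology for which all functionals
`x ↦ ∑ₙ ⟨ξₙ, x ηₙ⟩` with `∑ ‖ξₙ‖² < ∞` and `∑ ‖ηₙ‖² < ∞` are continuous. -/
@[reducible] noncomputable def ultraweakTopology (H : Type u) [NormedAddCommGroup H] [InnerProductSpace ℂ H]
    [CompleteSpace H] : TopologicalSpace (H →L[ℂ] H) :=
  ⨅ p : SqSummablePair H, TopologicalSpace.induced p.functional inferInstance

namespace VonNeumannAlgebra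

/-- The ultraweak topology of a von Neumann algebra `M ⊆ B(H)`. -/
@[reducible] noncomputable def ultraweak (M : VonNeumannAlgebra H) : TopologicalSpace M :=
  TopologicalSpace.induced Subtype.val (ultraweakTopology H)

/-- A total ideal of a von Neumann algebra: an ultraweakly closed two-sided ideal.
(In a commutative von Neumann algebra: an ultraweakly closed ideal.) -/
structure TotalIdeal (M : VonNeumannAlgebra H) where
  /-- the underlying two-sided ideal -/
  ideal : TwoSidedIdeal M
  isClosed : IsClosed[M.ultraweak] (ideal : Set M)

/-- A total ideal of `M`, as a set of operators on `H`. -/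
def TotalIdeal.toSet {M : VonNeumannAlgebra H} (I : M.TotalIdeal) : Set (H →L[ℂ] H) :=
  Subtype.val '' (I.ideal : Set M)

/-- The commutative sub-von-Neumann-algebras of `A` (with the same unit as `A`). -/
structure CommSub (A : VonNeumannAlgebra H) where
  /-- the underlying von Neumann algebra on `H` -/
  alg : VonNeumannAlgebra H
  le : alg ≤ A
  comm : ∀ x ∈ alg, ∀ y ∈ alg, x * y = y * x

/-- The map `x ↦ u x u*` on `B(H)`. -/
noncomputable def adMap (u : unitary (H →L[ℂ] H)) (x : H →L[ℂ] H) : H →L[ℂ] H :=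
  (u : H →L[ℂ] H) * x * star (u : H →L[ℂ] H)

theorem centralizer_image_starAlgAut (e : (H →L[ℂ] H) ≃⋆ₐ[ℂ] (H →L[ℂ] H))
    (S : Set (H →L[ℂ] H)) : Set.centralizer (e '' S) = e '' Set.centralizer S := by
  ext y
  simp only [Set.mem_centralizer_iff, Set.mem_image, forall_exists_index, and_imp,
    forall_apply_eq_imp_iff₂]
  constructor
  · intro h
    refine ⟨e.symm y, fun m hm => e.injective ?_, by simp⟩
    change e (m * e.symm y) = e (e.symm y * m)
    rw [map_mul, map_mul, e.apply_symm_apply]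
    exact h m hm
  · rintro ⟨x, hx, rfl⟩ m hm
    rw [← map_mul, ← map_mul, hx m hm]

/-- The von Neumann algebra `u V u* = {u x u* | x ∈ V}`. -/
noncomputable def conj (V : VonNeumannAlgebra H) (u : unitary (H →L[ℂ] H)) :
    VonNeumannAlgebra H where
  toStarSubalgebra := V.toStarSubalgebra.map
    (Unitary.conjStarAlgAut ℂ (H →L[ℂ] H) u).toStarAlgHom
  centralizer_centralizer' := by
    change Set.centralizer (Set.centralizer
      (Unitary.conjStarAlgAut ℂ (H →L[ℂ] H) u '' (V : Set (H →L[ℂ] H)))) =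
      Unitary.conjStarAlgAut ℂ (H →L[ℂ] H) u '' (V : Set (H →L[ℂ] H))
    rw [centralizer_image_starAlgAut, centralizer_image_starAlgAut, V.centralizer_centralizer]

theorem coe_conj (V : VonNeumannAlgebra H) (u : unitary (H →L[ℂ] H)) :
    (V.conj u : Set (H →L[ℂ] H)) = adMap u '' (V : Set (H →L[ℂ] H)) :=
  rfl

/-- For a unitary `u` of `A`, the commutative sub-von-Neumann-algebra `u V u*` of `A`. -/
noncomputable def CommSub.conj {A : VonNeumannAlgebra H} (V : A.CommSub)
    (u : unitary (H →L[ℂ] H)) (hu : (u : H →L[ℂ] H) ∈ A) : A.CommSub where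
  alg := V.alg.conj u
  le := by
    intro y hy
    obtain ⟨x, hx, rfl⟩ : y ∈ adMap u '' (V.alg : Set (H →L[ℂ] H)) := hy
    exact mul_mem (mul_mem hu (V.le hx)) (star_mem hu)
  comm := by
    intro y hy z hz
    obtain ⟨x, hx, rfl⟩ : y ∈ Unitary.conjStarAlgAut ℂ (H →L[ℂ] H) u ''
      (V.alg : Set (H →L[ℂ] H)) := hy
    obtain ⟨w, hw, rfl⟩ : z ∈ Unitary.conjStarAlgAut ℂ (H →L[ℂ] H) u ''
      (V.alg : Set (H →L[ℂ] H)) := hz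
    rw [← map_mul, ← map_mul, V.comm x hx w hw]

/-- A partial ideal of `A`: an assignment of an ultraweakly closed ideal `π(V)` of `V` to each
commutative sub-von-Neumann-algebra `V` of `A`, with `π(V) = π(W) ∩ V` whenever `V ⊆ W`. -/
structure PartialIdeal (A : VonNeumannAlgebra H) where
  /-- the ideal `π(V)` -/
  ideal : ∀ V : A.CommSub, V.alg.TotalIdeal
  compat : ∀ V W : A.CommSub, V.alg ≤ W.alg →
    (ideal V).toSet = (ideal W).toSet ∩ (V.alg : Set (H →L[ℂ] H))

/-- A partial ideal is invariant if `π(u V u*) = u π(V) u*` for all `V` and all unitaries `u`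
of `A`. -/
def PartialIdeal.IsInvariant {A : VonNeumannAlgebra H} (π : A.PartialIdeal) : Prop :=
  ∀ (V : A.CommSub) (u : unitary (H →L[ℂ] H)) (hu : (u : H →L[ℂ] H) ∈ A),
    (π.ideal (V.conj u hu)).toSet = adMap u '' (π.ideal V).toSet

theorem continuous_inclusion {V A : VonNeumannAlgebra H} (h : V ≤ A) :
    @Continuous V A V.ultraweak A.ultraweak (fun x => ⟨x.1, h x.2⟩) := by
  let := ultraweakTopology H
  let := A.ultraweak
  let := V.ultraweak
  exact continuous_induced_rng.2 continuous_induced_dom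

/-- The ideal `I ∩ V` of a von Neumann algebra `V ⊆ A`, for a total ideal `I` of `A`. -/
def TotalIdeal.restrict {V A : VonNeumannAlgebra H} (I : A.TotalIdeal) (h : V ≤ A) :
    V.TotalIdeal where
  ideal := TwoSidedIdeal.mk' {x : V | (⟨x.1, h x.2⟩ : A) ∈ I.ideal}
    I.ideal.zero_mem
    (fun hx hy => I.ideal.add_mem hx hy)
    (fun hx => I.ideal.neg_mem hx)
    (fun {x _} hy => I.ideal.mul_mem_left ⟨x.1, h x.2⟩ _ hy)
    (fun {_ y} hx => I.ideal.mul_mem_right _ ⟨y.1, h y.2⟩ hx)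
  isClosed := by
    rw [TwoSidedIdeal.coe_mk']
    exact @IsClosed.preimage _ _ V.ultraweak A.ultraweak _ (continuous_inclusion h) _ I.isClosed

theorem TotalIdeal.toSet_restrict {V A : VonNeumannAlgebra H} (I : A.TotalIdeal) (h : V ≤ A) :
    (I.restrict h).toSet = I.toSet ∩ (V : Set (H →L[ℂ] H)) := by
  ext x
  simp only [toSet, restrict, TwoSidedIdeal.coe_mk', Set.mem_image, Set.mem_inter_iff]
  constructor
  · rintro ⟨y, hy, rfl⟩
    exact ⟨⟨_, hy, rfl⟩, y.2⟩
  · rintro ⟨⟨y, hy, rfl⟩, hx⟩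
    exact ⟨⟨y.1, hx⟩, hy, rfl⟩

/-- The partial ideal `π_I : V ↦ I ∩ V` of `A` given by a total ideal `I` of `A`. -/
def TotalIdeal.toPartialIdeal {A : VonNeumannAlgebra H} (I : A.TotalIdeal) : A.PartialIdeal where
  ideal V := I.restrict V.le
  compat V W h := by
    rw [I.toSet_restrict, I.toSet_restrict, Set.inter_assoc, Set.inter_eq_right.2 h]

end VonNeumannAlgebra

end PartialIdeals

/-!
The proof works with projections. A total ideal contains, with each element `x`, the range
projection of `x x*`: this is the strong limit of the bounded sequence `T (T + 1/n)⁻¹` with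
`T = x x*`, and bounded strong limits are ultraweak limits. As `x` is a multiple of that projection,
total ideals are determined by their projections (`TotalIdeal.toSet_subset_of_isStarProjection`).
Every projection lies in the commutative subalgebra it generates, so `I ↦ π_I` is injective.

For an invariant partial ideal `π`, consider the set `P` of all projections that lie in some `π(V)`.
By compatibility, `q ∈ P` lies in `π(V)` for every `V` that contains `q`; hence `P` is closed under
subprojections, sums of orthogonal projections and suprema of chains, and under unitary conjugation
since `π` is invariant. By Zorn's lemma `P` has a maximal element `p`. It is the largest one: given
`q ∈ P`, let `r` be the range projection of `|p - q|`. A symmetry `u` built from the sign of `p - q`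
conjugates `q r` to `(1 - p) r` (`exists_unitary_conj_eq`), so the latter is a projection in `P`
orthogonal to `p`, and it vanishes by maximality; then `q r = 0` as well, and `q ≤ p` because
`p` and `q` agree on the kernel of `p - q`. Being the largest element of a set invariant under
unitary conjugation, `p` is central, and `P` consists of the projections below `p`. Thus `π(V)` and
`p A ∩ V` have the same projections for every `V`, and they are equal.
-/

/-! ### Range projections -/

section RangeProjection

variable {H : Type u} [NormedAddCommGroup H] [InnerProductSpace ℂ H] [CompleteSpace H]

/-- The range projection of `T`: the orthogonal projection onto the closure of its range. -/
noncomputable def rangeProj (T : H →L[ℂ] H) : H →L[ℂ] H :=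
  T.range.topologicalClosure.starProjection

theorem isStarProjection_rangeProj (T : H →L[ℂ] H) : IsStarProjection (rangeProj T) :=
  isStarProjection_starProjection

theorem rangeProj_mul_self (T : H →L[ℂ] H) : rangeProj T * T = T := by
  ext x
  exact Submodule.starProjection_eq_self_iff.2
    (Submodule.le_topologicalClosure _ (LinearMap.mem_range_self _ x))

theorem self_mul_rangeProj {T : H →L[ℂ] H} (hT : IsSelfAdjoint T) : T * rangeProj T = T := by
  simpa [hT.star_eq, (isStarProjection_rangeProj T).isSelfAdjoint.star_eq]
    using congr(star $(rangeProj_mul_self T))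

theorem mul_rangeProj_eq_zero {T y : H →L[ℂ] H} (h : y * T = 0) : y * rangeProj T = 0 := by
  ext x
  have hle : T.range.topologicalClosure ≤ y.ker := by
    refine Submodule.topologicalClosure_minimal _ ?_ y.isClosed_ker
    rintro _ ⟨z, rfl⟩
    exact congr($h z)
  exact hle (Submodule.starProjection_apply_mem _ x)

theorem mul_rangeProj_congr {T y z : H →L[ℂ] H} (h : y * T = z * T) :
    y * rangeProj T = z * rangeProj T := by
  rw [← sub_eq_zero, ← sub_mul] at h ⊢
  exact mul_rangeProj_eq_zero h

theorem Commute.rangeProj_right {T x : H →L[ℂ] H} (hT : IsSelfAdjoint T) (h : Commute x T) :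
    Commute x (rangeProj T) := by
  have key : ∀ y : H →L[ℂ] H, Commute y T → y * rangeProj T = rangeProj T * y * rangeProj T := by
    intro y hy
    refine mul_rangeProj_congr ?_
    rw [mul_assoc, hy.eq, ← mul_assoc, rangeProj_mul_self]
  have hs : Commute (star x) T := by simpa [hT.star_eq] using h.star_star
  have h2 := congr(star $(key _ hs))
  rw [star_mul, star_mul, star_mul, _root_.star_star,
    (isStarProjection_rangeProj T).isSelfAdjoint.star_eq] at h2
  rw [commute_iff_eq, key x h, mul_assoc]
  exact h2.symm

/-- The range projection of a positive operator `T` is the strong limit of the contractions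
`T (T + 1/(n+1))⁻¹`; the resolvents `g n = (T + 1/(n+1))⁻¹` come from the functional calculus. -/
theorem exists_tendsto_rangeProj {T : H →L[ℂ] H} (hT : 0 ≤ T) :
    ∃ g : ℕ → H →L[ℂ] H, (∀ n y, Commute T y → Commute (g n) y) ∧ (∀ n, ‖T * g n‖ ≤ 1) ∧
      ∀ x, Filter.Tendsto (fun n => (T * g n) x) Filter.atTop (𝓝 (rangeProj T x)) := by
  have hTs : IsSelfAdjoint T := .of_nonneg hT
  have hsp : ∀ t ∈ spectrum ℝ T, 0 ≤ t := fun t ht => spectrum_nonneg_of_nonneg hT ht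
  have hpos : ∀ n : ℕ, (0 : ℝ) < 1 / (n + 1) := fun n => Nat.one_div_pos_of_nat
  let f : ℕ → ℝ → ℝ := fun n t => (t + 1 / (n + 1))⁻¹
  have hf : ∀ n, ContinuousOn (f n) (spectrum ℝ T) := fun n =>
    ContinuousOn.inv₀ (by fun_prop) fun t ht => (add_pos_of_nonneg_of_pos (hsp t ht) (hpos n)).ne'
  have hmul : ∀ n, T * cfc (f n) T = cfc (fun t => t * f n t) T := fun n => by
    rw [cfc_mul (fun t => t) (f n) T continuousOn_id (hf n), cfc_id' ℝ T]
  have hcom : ∀ n y, Commute T y → Commute (cfc (f n) T) y := fun n y hy => hy.cfc_real _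
  have hnorm : ∀ n, ‖T * cfc (f n) T‖ ≤ 1 := fun n => by
    rw [hmul]
    refine norm_cfc_le zero_le_one fun t ht => ?_
    have h1 := add_pos_of_nonneg_of_pos (hsp t ht) (hpos n)
    rw [Real.norm_of_nonneg (mul_nonneg (hsp t ht) (inv_nonneg.2 h1.le)), ← div_eq_mul_inv,
      div_le_one h1]
    linarith [hpos n]
  have hdiff : ∀ n, ‖T * cfc (f n) T * T - T‖ ≤ 1 / (n + 1) := fun n => by
    have : T * cfc (f n) T * T - T = cfc (fun t => t * f n t * t - t) T := by
      rw [cfc_sub (fun t => t * f n t * t) (fun t => t) T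
        ((continuousOn_id.mul (hf n)).mul continuousOn_id) continuousOn_id,
        cfc_mul (fun t => t * f n t) (fun t => t) T (continuousOn_id.mul (hf n)) continuousOn_id,
        cfc_id' ℝ T, hmul]
    rw [this]
    refine norm_cfc_le (hpos n).le fun t ht => ?_
    have h0 := hsp t ht
    have h1 := add_pos_of_nonneg_of_pos h0 (hpos n)
    have h2 : t * f n t * t - t = -(1 / (n + 1) * (t / (t + 1 / (n + 1)))) := by
      simp only [f]
      field_simp
      ring
    have h3 : t / (t + 1 / (n + 1)) ≤ 1 := (div_le_one h1).2 (by linarith [hpos n])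
    rw [h2, norm_neg, Real.norm_of_nonneg (mul_nonneg (hpos n).le (div_nonneg h0 h1.le))]
    exact mul_le_of_le_one_right (hpos n).le h3
  refine ⟨fun n => cfc (f n) T, hcom, hnorm, fun x => ?_⟩
  have hR : ∀ n, T * cfc (f n) T = T * cfc (f n) T * rangeProj T := fun n => by
    have hc : Commute T (cfc (f n) T) := (hcom n T (Commute.refl T)).symm
    rw [hc.eq, mul_assoc, self_mul_rangeProj hTs]
  -- The operators `T g n` fix vectors of the range of `T` in the limit; being contractions, they
  -- do so on its closure.
  have hcl : ∀ v ∈ T.range.topologicalClosure,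
      Filter.Tendsto (fun n => (T * cfc (f n) T) v) Filter.atTop (𝓝 v) := by
    intro v hv
    rw [Metric.tendsto_atTop]
    intro ε hε
    obtain ⟨_, ⟨w, rfl⟩, hw⟩ := Metric.mem_closure_iff.1 hv (ε / 3) (by positivity)
    have hlim : Filter.Tendsto (fun n : ℕ => (1 : ℝ) / (n + 1) * ‖w‖) Filter.atTop (𝓝 (0 * ‖w‖)) :=
      tendsto_one_div_add_atTop_nhds_zero_nat.mul_const _
    rw [zero_mul] at hlim
    obtain ⟨N, hN⟩ := Filter.eventually_atTop.1
      (hlim.eventually_lt_const (show 0 < ε / 3 by positivity))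
    refine ⟨N, fun n hn => ?_⟩
    have e1 : dist ((T * cfc (f n) T) v) ((T * cfc (f n) T) (T w)) < ε / 3 := by
      rw [dist_eq_norm, ← map_sub]
      refine ((T * cfc (f n) T).le_of_opNorm_le (hnorm n) _).trans_lt ?_
      rw [one_mul, ← dist_eq_norm]
      exact hw
    have e2 : dist ((T * cfc (f n) T) (T w)) (T w) < ε / 3 := by
      rw [dist_eq_norm]
      exact ((T * cfc (f n) T * T - T).le_of_opNorm_le (hdiff n) w).trans_lt (hN n hn)
    have e3 : dist (T w) v < ε / 3 := by rw [dist_comm]; exact hw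
    linarith [dist_triangle4 ((T * cfc (f n) T) v) ((T * cfc (f n) T) (T w)) (T w) v]
  refine (hcl _ (Submodule.starProjection_apply_mem _ x)).congr fun n => ?_
  exact congr($(hR n) x).symm

end RangeProjection

/-! ### Strong limits and ultraweakly closed ideals -/

theorem SqSummablePair.tendsto_functional {H : Type u} [NormedAddCommGroup H]
    [InnerProductSpace ℂ H] (p : SqSummablePair H) {ι : Type*} {l : Filter ι}
    {f : ι → H →L[ℂ] H} {s : H →L[ℂ] H} {C : ℝ} (hC : ∀ i, ‖f i‖ ≤ C)
    (hs : ∀ x, Filter.Tendsto (fun i => f i x) l (𝓝 (s x))) :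
    Filter.Tendsto (fun i => p.functional (f i)) l (𝓝 (p.functional s)) := by
  refine tendsto_tsum_of_dominated_convergence
    (bound := fun n => |C| * (‖p.1.1 n‖ ^ 2 + ‖p.1.2 n‖ ^ 2))
    ((p.2.1.add p.2.2).mul_left _) (fun n => tendsto_const_nhds.inner (hs _))
    (Filter.Eventually.of_forall fun i n => ?_)
  have h1 : ‖f i (p.1.2 n)‖ ≤ |C| * ‖p.1.2 n‖ :=
    (f i).le_of_opNorm_le ((hC i).trans (le_abs_self C)) _
  calc ‖inner ℂ (p.1.1 n) (f i (p.1.2 n))‖ ≤ ‖p.1.1 n‖ * ‖f i (p.1.2 n)‖ := norm_inner_le_norm _ _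
    _ ≤ ‖p.1.1 n‖ * (|C| * ‖p.1.2 n‖) := by gcongr
    _ = |C| * (‖p.1.1 n‖ * ‖p.1.2 n‖) := by ring
    _ ≤ |C| * (‖p.1.1 n‖ ^ 2 + ‖p.1.2 n‖ ^ 2) := by
      gcongr
      nlinarith [sq_nonneg (‖p.1.1 n‖ - ‖p.1.2 n‖), sq_nonneg ‖p.1.1 n‖, sq_nonneg ‖p.1.2 n‖]

namespace VonNeumannAlgebra

variable {H : Type u} [NormedAddCommGroup H] [InnerProductSpace ℂ H] [CompleteSpace H]

theorem mem_of_forall_commute {M : VonNeumannAlgebra H} {x : H →L[ℂ] H}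
    (h : ∀ y ∈ M.commutant, Commute y x) : x ∈ M := by
  rw [← M.commutant_commutant, mem_commutant_iff]
  exact h

theorem commute_of_mem_commutant {M : VonNeumannAlgebra H} {x y : H →L[ℂ] H}
    (hx : x ∈ M) (hy : y ∈ M.commutant) : Commute y x :=
  (mem_commutant_iff.1 hy x hx).symm

theorem rangeProj_mem {M : VonNeumannAlgebra H} {T : H →L[ℂ] H} (hT : IsSelfAdjoint T)
    (h : T ∈ M) : rangeProj T ∈ M :=
  mem_of_forall_commute fun _ hy => (commute_of_mem_commutant h hy).rangeProj_right hT

theorem mem_of_tendsto {M : VonNeumannAlgebra H} {ι : Type*} {l : Filter ι} [l.NeBot]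
    {f : ι → H →L[ℂ] H} {s : H →L[ℂ] H} (hf : ∀ i, f i ∈ M)
    (hs : ∀ x, Filter.Tendsto (fun i => f i x) l (𝓝 (s x))) : s ∈ M := by
  refine mem_of_forall_commute fun y hy => ?_
  ext x
  have h1 : Filter.Tendsto (fun i => y (f i x)) l (𝓝 (y (s x))) :=
    (y.continuous.tendsto _).comp (hs x)
  refine tendsto_nhds_unique (h1.congr fun i => ?_) (hs (y x))
  exact congr($(commute_of_mem_commutant (hf i) hy) x)

namespace TotalIdeal

variable {M : VonNeumannAlgebra H} {I J : M.TotalIdeal}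

theorem mem_of_mem_toSet {x : H →L[ℂ] H} (hx : x ∈ I.toSet) : x ∈ M := by
  obtain ⟨y, -, rfl⟩ := hx
  exact y.2

theorem mem_toSet_iff {x : H →L[ℂ] H} (hx : x ∈ M) : x ∈ I.toSet ↔ (⟨x, hx⟩ : M) ∈ I.ideal := by
  constructor
  · rintro ⟨y, hy, rfl⟩
    exact hy
  · exact fun h => ⟨_, h, rfl⟩

theorem zero_mem_toSet : (0 : H →L[ℂ] H) ∈ I.toSet := ⟨0, I.ideal.zero_mem, rfl⟩

theorem add_mem_toSet {x y : H →L[ℂ] H} (hx : x ∈ I.toSet) (hy : y ∈ I.toSet) :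
    x + y ∈ I.toSet := by
  obtain ⟨x, hx, rfl⟩ := hx
  obtain ⟨y, hy, rfl⟩ := hy
  exact ⟨x + y, I.ideal.add_mem hx hy, rfl⟩

theorem mul_mem_toSet_left {x y : H →L[ℂ] H} (hx : x ∈ M) (hy : y ∈ I.toSet) :
    x * y ∈ I.toSet := by
  obtain ⟨y, hy, rfl⟩ := hy
  exact ⟨⟨x, hx⟩ * y, I.ideal.mul_mem_left _ _ hy, rfl⟩

theorem mul_mem_toSet_right {x y : H →L[ℂ] H} (hx : x ∈ I.toSet) (hy : y ∈ M) :
    x * y ∈ I.toSet := by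
  obtain ⟨x, hx, rfl⟩ := hx
  exact ⟨x * ⟨y, hy⟩, I.ideal.mul_mem_right _ _ hx, rfl⟩

theorem toSet_injective : Function.Injective (toSet : M.TotalIdeal → Set (H →L[ℂ] H)) := by
  rintro ⟨I, hI⟩ ⟨J, hJ⟩ h
  have : I = J := SetLike.coe_injective (Subtype.val_injective.image_injective h)
  subst this
  rfl

/-- Bounded strongly convergent nets converge ultraweakly, so total ideals contain their limits. -/
theorem mem_toSet_of_tendsto {ι : Type*} {l : Filter ι} [l.NeBot] {f : ι → H →L[ℂ] H}
    {s : H →L[ℂ] H} {C : ℝ} (hf : ∀ i, f i ∈ I.toSet) (hC : ∀ i, ‖f i‖ ≤ C)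
    (hs : ∀ x, Filter.Tendsto (fun i => f i x) l (𝓝 (s x))) : s ∈ I.toSet := by
  have hsM : s ∈ M := mem_of_tendsto (fun i => mem_of_mem_toSet (hf i)) hs
  rw [mem_toSet_iff hsM]
  obtain ⟨t, ht, hIt⟩ := (@isClosed_induced_iff _ _ (ultraweakTopology H) _ _).1 I.isClosed
  have hlim : Filter.Tendsto f l (@nhds _ (ultraweakTopology H) s) := by
    rw [nhds_iInf, Filter.tendsto_iInf]
    intro p
    rw [nhds_induced, Filter.tendsto_comap_iff]
    exact p.tendsto_functional hC hs
  have hst : s ∈ t := by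
    refine @IsClosed.mem_of_tendsto _ (ultraweakTopology H) _ _ _ _ _ _ ht hlim
      (Filter.Eventually.of_forall fun i => ?_)
    obtain ⟨y, hy, hyi⟩ := hf i
    rw [← hyi]
    exact (Set.ext_iff.1 hIt y).2 hy
  exact (Set.ext_iff.1 hIt ⟨s, hsM⟩).1 hst

theorem rangeProj_mem_toSet {T : H →L[ℂ] H} (hT : 0 ≤ T) (h : T ∈ I.toSet) :
    rangeProj T ∈ I.toSet := by
  obtain ⟨g, hg, hn, hlim⟩ := exists_tendsto_rangeProj hT
  refine mem_toSet_of_tendsto (fun n => mul_mem_toSet_right h ?_) hn hlim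
  exact mem_of_forall_commute fun y hy =>
    (hg n y (commute_of_mem_commutant (mem_of_mem_toSet h) hy).symm).symm

/-- A total ideal is determined by its projections: `x ∈ I` is a multiple of the range projection
of `x x*`, which lies in `I`. -/
theorem toSet_subset_of_isStarProjection 
    (h : ∀ p, IsStarProjection p → p ∈ I.toSet → p ∈ J.toSet) : I.toSet ⊆ J.toSet := by
  intro x hx
  have hxM := mem_of_mem_toSet hx
  have hR : rangeProj (x * star x) ∈ J.toSet := h _ (isStarProjection_rangeProj _)
    (rangeProj_mem_toSet (mul_star_self_nonneg x) (mul_mem_toSet_right hx (star_mem hxM)))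
  set R := rangeProj (x * star x)
  have h0 : (1 - R) * x = 0 := by
    rw [← CStarRing.mul_star_self_eq_zero_iff, star_mul, mul_assoc, ← mul_assoc x, ← mul_assoc,
      sub_mul, one_mul, rangeProj_mul_self, sub_self, zero_mul]
  have hRx : R * x = x := by
    rw [sub_mul, one_mul, sub_eq_zero] at h0
    exact h0.symm
  rw [← hRx]
  exact mul_mem_toSet_right hR hxM

end TotalIdeal

/-! ### Commutative subalgebras generated by commuting operators -/

/-- The von Neumann algebra generated by a set of operators: the bicommutant of the set together
with its adjoints. -/
noncomputable def generate (X : Set (H →L[ℂ] H)) : VonNeumannAlgebra H where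
  toStarSubalgebra := StarSubalgebra.centralizer ℂ (StarSubalgebra.centralizer ℂ X : Set _)
  centralizer_centralizer' := by
    change Set.centralizer (Set.centralizer (StarSubalgebra.centralizer ℂ
      (StarSubalgebra.centralizer ℂ X : Set (H →L[ℂ] H)) : Set (H →L[ℂ] H))) =
      (StarSubalgebra.centralizer ℂ (StarSubalgebra.centralizer ℂ X : Set (H →L[ℂ] H)) :
        Set (H →L[ℂ] H))
    rw [StarSubalgebra.coe_centralizer_centralizer, Set.centralizer_centralizer_centralizer]

theorem coe_generate (X : Set (H →L[ℂ] H)) :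
    (generate X : Set (H →L[ℂ] H)) = (X ∪ star X).centralizer.centralizer :=
  StarSubalgebra.coe_centralizer_centralizer ℂ X

theorem subset_generate (X : Set (H →L[ℂ] H)) : X ⊆ generate X := by
  rw [coe_generate]
  exact Set.subset_union_left.trans Set.subset_centralizer_centralizer

theorem generate_le {X : Set (H →L[ℂ] H)} {M : VonNeumannAlgebra H} (h : X ⊆ M) :
    generate X ≤ M := by
  rw [← SetLike.coe_subset_coe, coe_generate, ← M.centralizer_centralizer]
  refine Set.centralizer_subset (Set.centralizer_subset (Set.union_subset h fun x hx => ?_))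
  simpa using star_mem (s := M) (h hx)

/-- The commutative von Neumann subalgebra generated by commuting selfadjoint operators. -/
noncomputable def CommSub.generate {A : VonNeumannAlgebra H} (X : Set (H →L[ℂ] H)) (hXA : X ⊆ A)
    (hX : ∀ x ∈ X, IsSelfAdjoint x) (hc : ∀ x ∈ X, ∀ y ∈ X, Commute x y) : A.CommSub where
  alg := VonNeumannAlgebra.generate X
  le := generate_le hXA
  comm := by
    have hstar : X ∪ star X = X := Set.union_eq_left.2 fun x hx => by
      have := hX _ hx
      rw [isSelfAdjoint_iff, star_star] at this
      rwa [this]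
    intro x hx y hy
    rw [← SetLike.mem_coe, coe_generate, hstar] at hx hy
    exact Set.centralizer_centralizer_comm_of_comm hc _ hx _ hy

/-! ### Projections of a partial ideal -/

namespace PartialIdeal

variable {A : VonNeumannAlgebra H} (π : A.PartialIdeal)

/-- The projections that belong to one of the ideals of a partial ideal. -/
def projections : Set (H →L[ℂ] H) :=
  {p | IsStarProjection p ∧ ∃ V : A.CommSub, p ∈ (π.ideal V).toSet}

variable {π} {p q : H →L[ℂ] H}

theorem mem_of_mem_projections (hp : p ∈ π.projections) : p ∈ A := by
  obtain ⟨-, V, hV⟩ := hp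
  exact V.le (TotalIdeal.mem_of_mem_toSet hV)

/-- Membership of a projection in the ideal `π(V)` does not depend on `V`, as `π(V)` and `π(W)` are
compared on the algebra generated by the projection. -/
theorem mem_ideal_of_mem_projections (hp : p ∈ π.projections) {W : A.CommSub} (hW : p ∈ W.alg) :
    p ∈ (π.ideal W).toSet := by
  have hpA := mem_of_mem_projections hp
  obtain ⟨hp, V, hV⟩ := hp
  let U : A.CommSub := CommSub.generate {p} (by simpa using hpA) (by simpa using hp.isSelfAdjoint)
    (by simp)
  have hpU : p ∈ U.alg := subset_generate {p} rfl
  have hUV : U.alg ≤ V.alg := generate_le (by simpa using TotalIdeal.mem_of_mem_toSet hV)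
  have hUW : U.alg ≤ W.alg := generate_le (by simpa using hW)
  have hU : p ∈ (π.ideal U).toSet := by
    rw [π.compat U V hUV]
    exact ⟨hV, hpU⟩
  rw [π.compat U W hUW] at hU
  exact hU.1

/-- The commutative von Neumann subalgebra generated by two commuting projections. -/
theorem exists_commSub_of_commute (hpA : p ∈ A) (hqA : q ∈ A) (hp : IsStarProjection p)
    (hq : IsStarProjection q) (h : Commute p q) : ∃ V : A.CommSub, p ∈ V.alg ∧ q ∈ V.alg :=
  ⟨CommSub.generate {p, q} (by simp [Set.insert_subset_iff, hpA, hqA])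
    (by simp [hp.isSelfAdjoint, hq.isSelfAdjoint]) (by simp [h, h.symm]),
    subset_generate {p, q} (by simp), subset_generate {p, q} (by simp)⟩

theorem mul_mem_projections (hp : p ∈ π.projections) (hqA : q ∈ A) (hq : IsStarProjection q)
    (h : Commute p q) : p * q ∈ π.projections := by
  obtain ⟨V, hpV, hqV⟩ := exists_commSub_of_commute (mem_of_mem_projections hp) hqA hp.1 hq h
  exact ⟨hp.1.mul hq h, V,
    TotalIdeal.mul_mem_toSet_right (mem_ideal_of_mem_projections hp hpV) hqV⟩

theorem add_mem_projections (hp : p ∈ π.projections) (hq : q ∈ π.projections) (h : p * q = 0) :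
    p + q ∈ π.projections := by
  have hqp : q * p = 0 := by
    simpa [hp.1.isSelfAdjoint.star_eq, hq.1.isSelfAdjoint.star_eq] using congr(star $h)
  obtain ⟨V, hpV, hqV⟩ := exists_commSub_of_commute (mem_of_mem_projections hp)
    (mem_of_mem_projections hq) hp.1 hq.1 (h.trans hqp.symm)
  exact ⟨hp.1.add hq.1 h, V, TotalIdeal.add_mem_toSet (mem_ideal_of_mem_projections hp hpV)
    (mem_ideal_of_mem_projections hq hqV)⟩

theorem IsInvariant.conj_mem_projections (hπ : π.IsInvariant) (hp : p ∈ π.projections)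
    {u : H →L[ℂ] H} (hu : u ∈ unitary (H →L[ℂ] H)) (huA : u ∈ A) :
    u * p * star u ∈ π.projections := by
  obtain ⟨hp, V, hV⟩ := hp
  refine ⟨⟨?_, hp.isSelfAdjoint.conjugate u⟩, V.conj ⟨u, hu⟩ huA, ?_⟩
  · rw [IsIdempotentElem, show u * p * star u * (u * p * star u) = u * p * (star u * u) * p * star u
      by simp only [mul_assoc], Unitary.star_mul_self_of_mem hu, mul_one, mul_assoc u p p,
      hp.isIdempotentElem.eq]
  · rw [hπ]
    exact ⟨p, hV, rfl⟩

/-- The supremum of a chain of projections of a partial ideal is its strong limit. -/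
theorem exists_upper_bound_of_isChain {c : Set (H →L[ℂ] H)} (hc : c ⊆ π.projections)
    (hchain : IsChain (· ≤ ·) c) (hne : c.Nonempty) : ∃ s ∈ π.projections, ∀ p ∈ c, p ≤ s := by
  let V : A.CommSub := CommSub.generate c (fun p hp => mem_of_mem_projections (hc hp))
    (fun p hp => (hc hp).1.isSelfAdjoint) fun p hp q hq => by
      rcases hchain.total hp hq with h | h
      · exact (hc hp).1.commute_of_le (hc hq).1 h
      · exact ((hc hq).1.commute_of_le (hc hp).1 h).symm
  have hV : ∀ p ∈ c, p ∈ (π.ideal V).toSet := fun p hp =>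
    mem_ideal_of_mem_projections (hc hp) (subset_generate c hp)
  have : Nonempty c := hne.to_subtype
  have : IsDirected c (· ≤ ·) := ⟨fun p q => by
    rcases hchain.total p.2 q.2 with h | h
    · exact ⟨q, h, le_rfl⟩
    · exact ⟨p, le_rfl, h⟩⟩
  have hproj : ∀ p : c, ∃ _ : p.1.range.HasOrthogonalProjection, p.1 = p.1.range.starProjection :=
    fun p => isStarProjection_iff_eq_starProjection_range.1 (hc p.2).1
  have : ∀ p : c, p.1.range.HasOrthogonalProjection := fun p => (hproj p).1
  have hmono : Monotone fun p : c => p.1.range := by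
    rintro p q hpq _ ⟨x, rfl⟩
    have h := ((hc p.2).1.le_iff_mul_eq_right (hc q.2).1).1 hpq
    exact ⟨p.1 x, congr($h x)⟩
  let s := (⨆ p : c, p.1.range).topologicalClosure.starProjection
  have hs : IsStarProjection s := isStarProjection_starProjection
  refine ⟨s, ⟨hs, V, ?_⟩, fun p hp => ((hc hp).1.le_iff_mul_eq_right hs).2 ?_⟩
  · refine TotalIdeal.mem_toSet_of_tendsto (l := Filter.atTop) (C := 1) (fun p : c => hV p p.2)
      (fun p => IsStarProjection.norm_le _ (hc p.2).1) fun x => ?_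
    refine (Submodule.starProjection_tendsto_closure_iSup _ hmono x).congr fun p => ?_
    exact congr($((hproj p).2) x).symm
  · ext x
    refine Submodule.starProjection_eq_self_iff.2 (Submodule.le_topologicalClosure _ ?_)
    exact Submodule.mem_iSup_of_mem (⟨p, hp⟩ : c) ⟨x, rfl⟩

theorem exists_maximal_projection (π : A.PartialIdeal) :
    ∃ p, Maximal (· ∈ π.projections) p := by
  have h0 : (0 : H →L[ℂ] H) ∈ π.projections :=
    ⟨.zero _, CommSub.generate ∅ (by simp) (by simp) (by simp), TotalIdeal.zero_mem_toSet⟩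
  obtain ⟨p, -, hp⟩ := zorn_le_nonempty₀ π.projections
    (fun c hc hchain q hq => exists_upper_bound_of_isChain hc hchain ⟨q, hq⟩) 0 h0
  exact ⟨p, hp⟩

end PartialIdeal

/-! ### Comparison of two projections -/

/-- With `S = p - q`, let `u` be the symmetry `2 e - 1` for `e` the range projection of the positive
part of `S`, so that `u S = |S|`, and let `r` be the range projection of `|S|`. As `S²` commutes
with `q` and `S q = (1 - p) S`, the symmetry `u` conjugates `q r` to `(1 - p) r`. -/
theorem exists_unitary_conj_eq {A : VonNeumannAlgebra H} {p q : H →L[ℂ] H} (hpA : p ∈ A)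
    (hqA : q ∈ A) (hp : IsStarProjection p) (hq : IsStarProjection q) :
    ∃ u ∈ unitary (H →L[ℂ] H), ∃ r, IsStarProjection r ∧ u ∈ A ∧ r ∈ A ∧ Commute p r ∧
      Commute q r ∧ (p - q) * r = p - q ∧ u * (q * r) * star u = (1 - p) * r := by
  have hpp := hp.isIdempotentElem.eq
  have hqq := hq.isIdempotentElem.eq
  set S := p - q with hS
  have hSs : IsSelfAdjoint S := hp.isSelfAdjoint.sub hq.isSelfAdjoint
  have hSA : S ∈ A := sub_mem hpA hqA
  have hBs : IsSelfAdjoint (CFC.abs S) := .of_nonneg (CFC.abs_nonneg S)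
  have hPs : IsSelfAdjoint S⁺ := .of_nonneg (CFC.posPart_nonneg S)
  have hBeq : S⁺ + S⁻ = CFC.abs S := CFC.posPart_add_negPart S
  have hcP : ∀ y, Commute y S → Commute y S⁺ := fun y hy => (hy.symm.cfcₙ_real _).symm
  have hcB' : ∀ y, Commute y (S * S) → Commute y (CFC.abs S) := fun y hy => by
    have : Commute (star S * S) y := by rw [hSs.star_eq]; exact hy.symm
    exact (this.cfcₙ_nnreal _).symm
  have hcB : ∀ y, Commute y S → Commute y (CFC.abs S) := fun y hy => hcB' y (hy.mul_right hy)
  have hPA : S⁺ ∈ A := mem_of_forall_commute fun y hy => hcP y (commute_of_mem_commutant hSA hy)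
  have hBA : CFC.abs S ∈ A :=
    mem_of_forall_commute fun y hy => hcB y (commute_of_mem_commutant hSA hy)
  let e := rangeProj S⁺
  let r := rangeProj (CFC.abs S)
  let u := 2 * e - 1
  have he : IsStarProjection e := isStarProjection_rangeProj _
  have hr : IsStarProjection r := isStarProjection_rangeProj _
  have hu : u ∈ unitary (H →L[ℂ] H) := he.two_mul_sub_one_mem_unitary
  have huS : IsSelfAdjoint u := by
    have := he.isSelfAdjoint.star_eq
    simp [u, isSelfAdjoint_iff, two_mul, this]
  have huu : u * u = 1 := by
    have := Unitary.star_mul_self_of_mem hu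
    rwa [huS.star_eq] at this
  have heA : e ∈ A := rangeProj_mem hPs hPA
  have huA : u ∈ A := by
    have : u = e + e - 1 := by simp [u, two_mul]
    rw [this]
    exact sub_mem (add_mem heA heA) (one_mem A)
  have hcu : ∀ y, Commute y S → Commute y u := fun y hy => by
    have h1 : Commute y e := (hcP y hy).rangeProj_right hPs
    have : u = e + e - 1 := by simp [u, two_mul]
    rw [this]
    exact (h1.add_right h1).sub_right (Commute.one_right y)
  have huS' : u * S = CFC.abs S := by
    have h1 : e * S⁺ = S⁺ := rangeProj_mul_self _
    have h2 : e * S⁻ = 0 := by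
      have h3 : S⁻ * e = 0 := mul_rangeProj_eq_zero (CFC.negPart_mul_posPart S)
      have hNs : IsSelfAdjoint S⁻ := .of_nonneg (CFC.negPart_nonneg S)
      simpa [hNs.star_eq, he.isSelfAdjoint.star_eq] using congr(star $h3)
    have h4 : e * S = S⁺ := by
      have : e * (S⁺ - S⁻) = S⁺ := by rw [mul_sub, h1, h2, sub_zero]
      rwa [CFC.posPart_sub_negPart S hSs] at this
    rw [← hBeq, sub_mul, one_mul, mul_assoc, h4]
    nth_rw 2 [← CFC.posPart_sub_negPart S hSs]
    rw [two_mul]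
    abel
  have hSu : Commute S u := hcu S (Commute.refl S)
  have hrB : r * CFC.abs S = CFC.abs S := rangeProj_mul_self _
  have hBr : CFC.abs S * r = CFC.abs S := self_mul_rangeProj hBs
  have hSB : S = u * CFC.abs S := by rw [← huS', ← mul_assoc, huu, one_mul]
  have hur : Commute u r := ((hcB u hSu.symm)).rangeProj_right hBs
  have hS2 : S * S = p + q - p * q - q * p := by
    simp only [hS, mul_sub, sub_mul, hpp, hqq]
    abel
  have hpB : Commute p (CFC.abs S) := hcB' p <| by
    rw [hS2, commute_iff_eq]
    simp only [mul_sub, sub_mul, mul_add, add_mul, mul_assoc, hpp, ← mul_assoc p p]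
    simp only [← mul_assoc]
    abel
  have hqB : Commute q (CFC.abs S) := hcB' q <| by
    rw [hS2, commute_iff_eq]
    simp only [mul_sub, sub_mul, mul_add, add_mul, mul_assoc, hqq, ← mul_assoc q q]
    simp only [← mul_assoc]
    abel
  have hpr : Commute p r := hpB.rangeProj_right hBs
  have hqr : Commute q r := hqB.rangeProj_right hBs
  have hSq : S * q = (1 - p) * S := by
    simp only [hS, mul_sub, sub_mul, hpp, hqq, one_mul]
    abel
  -- `u q |S| = S q = (1 - p) S = (1 - p) u |S|`, hence `u q r = (1 - p) u r`
  have hint : u * q * r = (1 - p) * u * r := by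
    refine mul_rangeProj_congr ?_
    rw [mul_assoc u, hqB.eq, ← mul_assoc, ← hSB, hSq, mul_assoc, ← hSB]
  refine ⟨u, hu, r, hr, huA, rangeProj_mem hBs hBA, hpr, hqr, ?_, ?_⟩
  · rw [hSB, mul_assoc, hBr]
  · rw [huS.star_eq, ← mul_assoc, hint, mul_assoc, ← hur.eq, mul_assoc, ← mul_assoc u, huu, one_mul]

/-! ### The largest projection of an invariant partial ideal -/

/-- An operator that commutes with all unitaries of a von Neumann algebra is in the commutant, as
the unitaries span the algebra. -/
theorem commute_of_commute_unitary {A : VonNeumannAlgebra H} {p : H →L[ℂ] H}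
    (h : ∀ u ∈ unitary (H →L[ℂ] H), u ∈ A → Commute p u) {a : H →L[ℂ] H} (ha : a ∈ A) :
    Commute p a := by
  have hclosed : IsClosed (A.toStarSubalgebra : Set (H →L[ℂ] H)) := by
    rw [coe_toStarSubalgebra, ← A.centralizer_centralizer]
    exact Set.isClosed_centralizer _
  let := StarSubalgebra.cstarAlgebra A.toStarSubalgebra (h_closed := hclosed)
  obtain ⟨u, c, hu, -⟩ := CStarAlgebra.exists_sum_four_unitary (⟨a, ha⟩ : A.toStarSubalgebra)
  have hu' : a = ∑ i, c i • ((u i : A.toStarSubalgebra) : H →L[ℂ] H) := by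
    simpa using congr(A.toStarSubalgebra.subtype $hu)
  rw [hu']
  refine Commute.sum_right _ _ _ fun i _ => (h _ ?_ (u i).1.2).smul_right _
  exact Unitary.map_mem A.toStarSubalgebra.subtype (u i).2

namespace PartialIdeal

variable {A : VonNeumannAlgebra H} {π : A.PartialIdeal} {p : H →L[ℂ] H}

/-- If `p` is a maximal projection and `q` is another one, conjugate the part `q r` of `q` off the
kernel of `p - q` to the projection `(1 - p) r`, orthogonal to `p`; maximality forces it to vanish,
and `p` and `q` agree on the kernel. -/
theorem IsInvariant.mul_eq_of_maximal (hπ : π.IsInvariant) (hp : Maximal (· ∈ π.projections) p)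
    {q : H →L[ℂ] H} (hq : q ∈ π.projections) : p * q = q := by
  have hpA := mem_of_mem_projections hp.prop
  have hpp := hp.prop.1.isIdempotentElem.eq
  obtain ⟨u, hu, r, hr, huA, hrA, hpr, hqr, hS, hconj⟩ :=
    exists_unitary_conj_eq hpA (mem_of_mem_projections hq) hp.prop.1 hq.1
  have h1 : (1 - p) * r ∈ π.projections := by
    rw [← hconj]
    exact hπ.conj_mem_projections (mul_mem_projections hq hrA hr hqr) hu huA
  have h2 : p * ((1 - p) * r) = 0 := by
    rw [← mul_assoc, hp.prop.1.mul_one_sub_self, zero_mul]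
  have h3 : p ≤ p + (1 - p) * r := le_add_of_nonneg_right h1.1.nonneg
  have h4 : (1 - p) * r = 0 := by
    have := hp.eq_of_le (add_mem_projections hp.prop h1 h2) h3
    simpa using this
  have h5 : q * r = 0 := by
    have h6 : star u * (u * (q * r) * star u) * u = q * r := by
      rw [mul_assoc u, ← mul_assoc, Unitary.star_mul_self_of_mem hu, one_mul, mul_assoc,
        Unitary.star_mul_self_of_mem hu, mul_one]
    rw [← h6, hconj, h4, mul_zero, zero_mul]
  have h7 : p * r = r := by
    rw [sub_mul, one_mul, sub_eq_zero] at h4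
    exact h4.symm
  have h8 : q = p * (1 - r) := by
    rw [sub_mul, h5, h7, sub_zero] at hS
    rw [mul_sub, mul_one, h7, hS]
    abel
  rw [h8, ← mul_assoc, hpp]

theorem IsInvariant.commute_of_maximal (hπ : π.IsInvariant)
    (hp : Maximal (· ∈ π.projections) p) {a : H →L[ℂ] H} (ha : a ∈ A) : Commute p a := by
  have key : ∀ u ∈ unitary (H →L[ℂ] H), u ∈ A → p * u * p = u * p := by
    intro u hu huA
    have := hπ.mul_eq_of_maximal hp (hπ.conj_mem_projections hp.prop hu huA)
    calc p * u * p = p * (u * p * star u) * u := by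
          simp only [mul_assoc, Unitary.star_mul_self_of_mem hu, mul_one]
      _ = u * p := by
          rw [this, mul_assoc, Unitary.star_mul_self_of_mem hu, mul_one]
  refine commute_of_commute_unitary (fun u hu huA => ?_) ha
  have h1 := congr(star $(key _ (Unitary.star_mem hu) (star_mem huA)))
  simp only [star_mul, star_star, hp.prop.1.isSelfAdjoint.star_eq] at h1
  rw [commute_iff_eq, ← h1, ← mul_assoc]
  exact key u hu huA

end PartialIdeal

/-! ### The total ideal of a central projection -/

theorem continuous_inner_apply (ξ η : H) :
    @Continuous _ _ (ultraweakTopology H) _ fun x : H →L[ℂ] H => inner ℂ ξ (x η) := by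
  have hsum : ∀ ζ : H, Summable fun n => ‖(Pi.single 0 ζ : ℕ → H) n‖ ^ 2 := fun ζ =>
    summable_of_ne_finset_zero (s := {0}) fun n hn => by
      rw [Pi.single_eq_of_ne (by simpa using hn)]
      simp
  let p : SqSummablePair H := ⟨(Pi.single 0 ξ, Pi.single 0 η), hsum ξ, hsum η⟩
  have hp : p.functional = fun x : H →L[ℂ] H => inner ℂ ξ (x η) := by
    ext x
    rw [SqSummablePair.functional, tsum_eq_single 0 fun n hn => by simp [p, hn]]
    simp [p]
  rw [← hp]
  exact continuous_iInf_dom (i := p) continuous_induced_dom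

/-- The total ideal `p A` of a central projection `p` of `A`. -/
noncomputable def centralIdeal {A : VonNeumannAlgebra H} (p : H →L[ℂ] H)
    (hp : ∀ a ∈ A, Commute p a) : A.TotalIdeal where
  ideal := TwoSidedIdeal.mk' {x : A | p * x.1 = x.1}
    (mul_zero p)
    (fun {x y} hx hy => (mul_add p x.1 y.1).trans (congrArg₂ _ hx hy))
    (fun {x} hx => (mul_neg p x.1).trans (congrArg _ hx))
    (fun {x y} hy => by
      change p * (x.1 * y.1) = x.1 * y.1
      rw [← mul_assoc, (hp x x.2).eq, mul_assoc, hy])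
    (fun {x y} hx => by
      change p * (x.1 * y.1) = x.1 * y.1
      rw [← mul_assoc, hx])
  isClosed := by
    rw [TwoSidedIdeal.coe_mk']
    have : {x : A | p * x.1 = x.1} = Subtype.val ⁻¹' ⋂ ξ : H, ⋂ η : H,
        {x : H →L[ℂ] H | inner ℂ (star (p - 1) ξ) (x η) = (0 : ℂ)} := by
      ext x
      simp only [Set.mem_ofPred_eq, Set.mem_preimage, Set.mem_iInter]
      rw [← sub_eq_zero, ← sub_one_mul, ContinuousLinearMap.star_eq_adjoint]
      simp only [ContinuousLinearMap.adjoint_inner_left]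
      constructor
      · intro h ξ η
        rw [← mul_apply_eq_comp, h]
        simp
      · intro h
        ext η
        exact inner_self_eq_zero.1 (h _ η)
    rw [this]
    refine (@isClosed_induced_iff _ _ (ultraweakTopology H) _ _).2 ⟨_, ?_, rfl⟩
    let := ultraweakTopology H
    refine @isClosed_iInter _ _ (ultraweakTopology H) _ fun ξ =>
      @isClosed_iInter _ _ (ultraweakTopology H) _ fun η => ?_
    exact @IsClosed.preimage _ _ (ultraweakTopology H) _ _ (continuous_inner_apply _ η) {0}
      isClosed_singleton

theorem mem_toSet_centralIdeal {A : VonNeumannAlgebra H} {p : H →L[ℂ] H}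
    {hp : ∀ a ∈ A, Commute p a} {x : H →L[ℂ] H} :
    x ∈ (centralIdeal p hp).toSet ↔ x ∈ A ∧ p * x = x := by
  constructor
  · intro h
    have hx := TotalIdeal.mem_of_mem_toSet h
    rw [TotalIdeal.mem_toSet_iff hx, centralIdeal, TwoSidedIdeal.mem_mk'] at h
    exact ⟨hx, h⟩
  · rintro ⟨hx, h⟩
    rw [TotalIdeal.mem_toSet_iff hx, centralIdeal, TwoSidedIdeal.mem_mk']
    exact h

/-! ### Total ideals and invariant partial ideals -/

theorem adMap_mem_toSet {A : VonNeumannAlgebra H} (I : A.TotalIdeal) {u : unitary (H →L[ℂ] H)}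
    (hu : (u : H →L[ℂ] H) ∈ A) {x : H →L[ℂ] H} (hx : x ∈ I.toSet) : adMap u x ∈ I.toSet :=
  TotalIdeal.mul_mem_toSet_right (TotalIdeal.mul_mem_toSet_left hu hx) (star_mem hu)

theorem adMap_star_adMap (u : unitary (H →L[ℂ] H)) (x : H →L[ℂ] H) :
    adMap (star u) (adMap u x) = x := by
  simp only [adMap, Unitary.coe_star, star_star]
  rw [mul_assoc (u : H →L[ℂ] H), ← mul_assoc, Unitary.coe_star_mul_self, one_mul, mul_assoc,
    Unitary.coe_star_mul_self, mul_one]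

namespace PartialIdeal

variable {A : VonNeumannAlgebra H} {π : A.PartialIdeal}

theorem isInvariant_of_forall_toSet_eq {I : A.TotalIdeal}
    (h : ∀ V : A.CommSub, (π.ideal V).toSet = I.toSet ∩ (V.alg : Set (H →L[ℂ] H))) :
    π.IsInvariant := by
  intro V u hu
  rw [h, h]
  have hV : ((V.conj u hu).alg : Set (H →L[ℂ] H)) = adMap u '' (V.alg : Set (H →L[ℂ] H)) :=
    coe_conj V.alg u
  rw [hV]
  ext y
  constructor
  · rintro ⟨hy, x, hx, rfl⟩
    refine ⟨x, ⟨?_, hx⟩, rfl⟩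
    rw [← adMap_star_adMap u x]
    exact adMap_mem_toSet I (star_mem hu) hy
  · rintro ⟨x, ⟨hxI, hx⟩, rfl⟩
    exact ⟨adMap_mem_toSet I hu hxI, x, hx, rfl⟩

theorem IsInvariant.exists_totalIdeal (hπ : π.IsInvariant) :
    ∃ I : A.TotalIdeal, ∀ V : A.CommSub,
      (π.ideal V).toSet = I.toSet ∩ (V.alg : Set (H →L[ℂ] H)) := by
  obtain ⟨p, hp⟩ := π.exists_maximal_projection
  let I : A.TotalIdeal := centralIdeal p fun a ha => hπ.commute_of_maximal hp ha
  refine ⟨I, fun V => ?_⟩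
  rw [← I.toSet_restrict V.le]
  refine (TotalIdeal.toSet_subset_of_isStarProjection fun q hq hqV => ?_).antisymm
    (TotalIdeal.toSet_subset_of_isStarProjection fun q hq hqI => ?_)
  · rw [I.toSet_restrict]
    have hqV' := TotalIdeal.mem_of_mem_toSet hqV
    exact ⟨mem_toSet_centralIdeal.2 ⟨V.le hqV', hπ.mul_eq_of_maximal hp ⟨hq, V, hqV⟩⟩, hqV'⟩
  · rw [I.toSet_restrict] at hqI
    obtain ⟨hqA, hpq⟩ := mem_toSet_centralIdeal.1 hqI.1
    refine mem_ideal_of_mem_projections ?_ hqI.2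
    rw [← hpq]
    exact mul_mem_projections hp.prop hqA hq (hπ.commute_of_maximal hp hqA)

theorem ext_toSet {π ρ : A.PartialIdeal} (h : ∀ V, (π.ideal V).toSet = (ρ.ideal V).toSet) :
    π = ρ := by
  obtain ⟨f, hf⟩ := π
  obtain ⟨g, hg⟩ := ρ
  have : f = g := funext fun V => TotalIdeal.toSet_injective (h V)
  subst this
  rfl

end PartialIdeal

theorem TotalIdeal.toSet_toPartialIdeal {A : VonNeumannAlgebra H} (I : A.TotalIdeal)
    (V : A.CommSub) : (I.toPartialIdeal.ideal V).toSet = I.toSet ∩ (V.alg : Set (H →L[ℂ] H)) :=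
  I.toSet_restrict V.le

/-- A projection of `A` lies in `I` if and only if it lies in `I ∩ V` for the algebra `V` that it
generates, so that the ideals `I ∩ V` determine `I`. -/
theorem TotalIdeal.toPartialIdeal_injective {A : VonNeumannAlgebra H} :
    Function.Injective (toPartialIdeal : A.TotalIdeal → A.PartialIdeal) := by
  have key : ∀ I J : A.TotalIdeal, I.toPartialIdeal = J.toPartialIdeal → I.toSet ⊆ J.toSet := by
    intro I J h
    refine toSet_subset_of_isStarProjection fun p hp hpI => ?_
    have hpA := mem_of_mem_toSet hpI
    obtain ⟨V, hpV, -⟩ := PartialIdeal.exists_commSub_of_commute hpA hpA hp hp (Commute.refl p)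
    have hV : p ∈ (I.toPartialIdeal.ideal V).toSet := by
      rw [toSet_toPartialIdeal]
      exact ⟨hpI, hpV⟩
    rw [h, toSet_toPartialIdeal] at hV
    exact hV.1
  exact fun I J h => toSet_injective ((key I J h).antisymm (key J I h.symm))

end VonNeumannAlgebra

theorem theorem1 {H : Type u} [NormedAddCommGroup H] [InnerProductSpace ℂ H] [CompleteSpace H]
    (A : VonNeumannAlgebra H) :
    (∀ π : A.PartialIdeal,
      (∃ I : A.TotalIdeal, ∀ V : A.CommSub,
        (π.ideal V).toSet = I.toSet ∩ (V.alg : Set (H →L[ℂ] H))) ↔ π.IsInvariant) ∧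
    Set.BijOn (fun I : A.TotalIdeal => I.toPartialIdeal) Set.univ
      {π : A.PartialIdeal | π.IsInvariant} := by
  refine ⟨fun π => ⟨fun ⟨_, h⟩ => VonNeumannAlgebra.PartialIdeal.isInvariant_of_forall_toSet_eq h,
    fun h => h.exists_totalIdeal⟩, fun I _ => ?_,
    VonNeumannAlgebra.TotalIdeal.toPartialIdeal_injective.injOn, fun π hπ => ?_⟩
  · exact VonNeumannAlgebra.PartialIdeal.isInvariant_of_forall_toSet_eq I.toSet_toPartialIdeal
  · obtain ⟨I, hI⟩ := VonNeumannAlgebra.PartialIdeal.IsInvariant.exists_totalIdeal hπ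
    exact ⟨I, trivial, VonNeumannAlgebra.PartialIdeal.ext_toSet fun V =>
      (I.toSet_toPartialIdeal V).trans (hI V).symm⟩
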